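/- All graphs are finite and simple. For a graph $G$ of order $n$ let $I(G,x)=\sum_{k=0}^{n}s(G,k)x^k$ be its independence polynomial, where $s(G,k)$ is the number of independent sets of $G$ of size $k$. The polynomial $I(G,x)$ of a graph with at least one vertex has a real root, and all its real roots are negative; let $\xi(G)$ be the largest one. Write $G\succeq H$ if $I(H,x)\ge I(G,x)$ for every $x\in[\xi(G),0]$, and $G\succ H$ if $G\succeq H$ and $I(G,x)\ne I(H,x)$. For integers $n_1,\dots,n_k\ge 2$ let $T(n_1,\dots,n_k)$ be the tree with a vertex $v$ of degree $k$ such that deleting $v$ leaves the disjoint union of paths $P_{n_1-1},\dots,P_{n_k-1}$ of orders $n_1-1,\dots,n_k-1$, where $v$ is adjacent to one end-vertex of each of these paths. For $1\le k\le n-1$ let $T_{n,k}=T(n-k+1,\underbrace{2,\dots,2}_{k-1})$, and let $H_{n,k}$ be the double star of order $n$ obtained from an edge $ab$ by attaching $k-1$ pendant vertices to $a$ and $n-k-1$ pendant vertices to $b$. Theorem. Let $n\ge 2$. Then: 1) $T_{n,n-1}\succ T_{n,n-2}\succ\cdots\succ T_{n,2}$, that is, $T_{n,j}\succ T_{n,k}$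 whenever $2\le k<j\le n-1$; 2) $H_{n,n-1}\succ H_{n,n-2}\succ\cdots\succ H_{n,\lceil n/2\rceil}$, that is, $H_{n,j}\succ H_{n,k}$ whenever $\lceil n/2\rceil\le k<j\le n-1$. -/

import Mathlib

open Polynomial

namespace IndepOrder

/-- The independence polynomial `I(G, x) = ∑ₖ s(G, k) xᵏ`, where `s(G, k)` is the number of
independent sets of `G` of size `k`. -/
noncomputable def indepPoly {V : Type*} [Fintype V] (G : SimpleGraph V) : ℝ[X] :=
  open Classical in
  ∑ k ∈ Finset.range (Fintype.card V + 1), C ((G.indepSetFinset k).card : ℝ) * X ^ k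

/-- `ξ` is the largest real root of `I(G, x)`. -/
def IsLargestRoot {V : Type*} [Fintype V] (G : SimpleGraph V) (ξ : ℝ) : Prop :=
  IsGreatest {x : ℝ | (indepPoly G).eval x = 0} ξ

/-- `G ⪰ H`: with `ξ` the largest real root of `I(G, x)`, one has `I(H, x) ≥ I(G, x)` on `[ξ, 0]`.
The existence of `ξ` (which holds for every graph with at least one vertex) is asserted as a part
of the relation, so that no default value of a supremum plays a role. -/
def Dominates {V W : Type*} [Fintype V] [Fintype W]
    (G : SimpleGraph V) (H : SimpleGraph W) : Prop :=
  ∃ ξ : ℝ, IsLargestRoot G ξ ∧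
    ∀ x ∈ Set.Icc ξ 0, (indepPoly G).eval x ≤ (indepPoly H).eval x

/-- `G ≻ H`: `G ⪰ H` and the independence polynomials are different. -/
def StrictlyDominates {V W : Type*} [Fintype V] [Fintype W]
    (G : SimpleGraph V) (H : SimpleGraph W) : Prop :=
  Dominates G H ∧ indepPoly G ≠ indepPoly H

/-- Vertices of `T(n₁, …, nₖ)`: the centre `none`, and for each `i` a path with `nᵢ - 1` vertices
`some ⟨i, 0⟩, some ⟨i, 1⟩, …`. -/
abbrev StarlikeVertex {k : ℕ} (l : Fin k → ℕ) : Type :=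
  Option (Σ i : Fin k, Fin (l i - 1))

/-- The tree `T(n₁, …, nₖ)` (with all `nᵢ ≥ 2`): the centre is joined to the first vertex of each
of `k` disjoint paths on `n₁ - 1, …, nₖ - 1` vertices. -/
def starlike {k : ℕ} (l : Fin k → ℕ) : SimpleGraph (StarlikeVertex l) :=
  SimpleGraph.fromRel fun u v =>
    match u, v with
    | none, some ⟨_, b⟩ => b.val = 0
    | some ⟨i, a⟩, some ⟨j, b⟩ => i = j ∧ a.val + 1 = b.val
    | _, none => False

/-- The sequence `(n - k + 1, 2, …, 2)` of length `k`. -/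
def broomLegs (n k : ℕ) : Fin k → ℕ :=
  fun i => if i.val = 0 then n - k + 1 else 2

/-- The tree `T_{n,k} = T(n - k + 1, 2, …, 2)` of order `n`, for `1 ≤ k ≤ n - 1`. -/
def treeT (n k : ℕ) : SimpleGraph (StarlikeVertex (broomLegs n k)) :=
  starlike (broomLegs n k)

/-- The double star `H_{n,k}` of order `n`, for `1 ≤ k ≤ n - 1`: two adjacent centres
`inl none`, `inr none`, carrying `k - 1` and `n - k - 1` pendant vertices. -/
def doubleStar (n k : ℕ) :
    SimpleGraph (Option (Fin (k - 1)) ⊕ Option (Fin (n - k - 1))) :=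
  SimpleGraph.sum (SimpleGraph.starGraph (none : Option (Fin (k - 1))))
      (SimpleGraph.starGraph (none : Option (Fin (n - k - 1)))) ⊔
    SimpleGraph.edge (Sum.inl none) (Sum.inr none)

end IndepOrder

namespace IndepOrder

open Finset

/-! ### The independence polynomial as a sum over indicator functions -/

/-! Write `t = 1 + x` and `p m = pathFun m x`. Conditioning on the centres gives closed forms: `t ^
(k - 1) * p (n - k + 1) + x * p (n - k)` for `treeT n k`, and a polynomial in `x` and powers of `t`
for `doubleStar n k`. Replacing `k + 1` by `k` in the tree changes the value by a square times a
path polynomial times `1 - t ^ (k - 1)` (`broomFun_sub_broomFun`). The path factor is positive as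
long as the tree polynomial has stayed positive going left from `0` (`pathFun_pos_of_broomFun_pos`).
For double stars the difference factors completely on `(-1, 0)`. `strictlyDominates_of_lt` turns
these pointwise inequalities into the order relation: `ξ` is the first zero met going left from `0`,
and it is at least `-1`. -/

/-- The independence polynomial at `x` as a sum over Boolean indicator functions. -/
theorem eval_indepPoly {V : Type*} [Fintype V] [DecidableEq V] (G : SimpleGraph V) (x : ℝ) :
    (indepPoly G).eval x = open Classical in ∑ f : V → Bool,
      if ∀ u v, G.Adj u v → ¬ (f u = true ∧ f v = true) then
        ∏ v, (bif f v then x else 1) else 0 := by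
  classical
  have h1 : (indepPoly G).eval x =
      ∑ s : Finset V, if G.IsIndepSet (s : Set V) then x ^ s.card else 0 := by
    rw [← Finset.sum_filter, ← Finset.sum_fiberwise_of_maps_to (g := Finset.card)
      (t := Finset.range (Fintype.card V + 1))]
    · simp only [indepPoly, eval_finsetSum, eval_mul, eval_C, eval_pow, eval_X]
      refine Finset.sum_congr rfl fun k _ => ?_
      rw [Finset.sum_congr rfl (g := fun _ => x ^ k), Finset.sum_const, nsmul_eq_mul]
      · congr 3
        ext s
        simp [SimpleGraph.mem_indepSetFinset_iff, SimpleGraph.isNIndepSet_iff]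
      · intro s hs
        rw [(Finset.mem_filter.1 hs).2]
    · intro s _
      exact Finset.mem_range.2 (Nat.lt_succ_of_le s.card_le_univ)
  rw [h1, ← Finset.sum_filter, ← Finset.sum_filter]
  refine Finset.sum_nbij' (fun s v => decide (v ∈ s)) (fun f => univ.filter fun v => f v = true)
    ?_ ?_ ?_ ?_ ?_
  · intro s hs
    have hs := (Finset.mem_filter.1 hs).2
    refine Finset.mem_filter.2 ⟨mem_univ _, fun u v huv h => ?_⟩
    simp only [decide_eq_true_eq] at h
    exact hs h.1 h.2 huv.ne huv
  · intro f hf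
    have hf := (Finset.mem_filter.1 hf).2
    refine Finset.mem_filter.2 ⟨mem_univ _, fun u hu v hv _ huv => ?_⟩
    simp only [coe_filter, mem_univ, true_and, Set.mem_ofPred_eq] at hu hv
    exact hf u v huv ⟨hu, hv⟩
  · intro s _
    ext v
    simp
  · intro f _
    ext v
    simp
  · intro s _
    simp [Bool.cond_eq_ite]

/-- A sum over functions of products of local weights is the product of the local sums. -/
theorem sum_bool_prod {ι : Type*} [Fintype ι] [DecidableEq ι] (w : ι → Bool → ℝ) :
    ∑ f : ι → Bool, ∏ i, w i (f i) = ∏ i, (w i true + w i false) := by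
  rw [← Fintype.piFinset_univ, ← Finset.prod_univ_sum]
  simp

/-! ### Paths -/

/-- `pathFun (m + 1) x` is the value at `x` of the independence polynomial of the path of
order `m`. -/
def pathFun : ℕ → ℝ → ℝ
  -- A convention for "order `-1`", chosen so that the recursion yields `1 + x` at index `2`.
  | 0, _ => 1
  | 1, _ => 1
  | m + 2, x => pathFun (m + 1) x + x * pathFun m x

/-- `f` indicates an independent set of the path `0, 1, …, m - 1`. -/
def PathIndep {m : ℕ} (f : Fin m → Bool) : Prop :=
  ∀ a b : Fin m, a.val + 1 = b.val → ¬ (f a = true ∧ f b = true)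

/-- `f` avoids the first vertex of the path `0, 1, …, m - 1`. -/
def AvoidsFirst {m : ℕ} (f : Fin m → Bool) : Prop :=
  ∀ a : Fin m, a.val = 0 → f a = false

theorem avoidsFirst_cons {m : ℕ} (b : Bool) (f : Fin m → Bool) :
    AvoidsFirst (Fin.cons b f : Fin (m + 1) → Bool) ↔ b = false := by
  constructor
  · intro h
    simpa using h 0 rfl
  · rintro h a ha
    obtain rfl : a = 0 := Fin.ext ha
    simpa using h

theorem pathIndep_cons {m : ℕ} (b : Bool) (f : Fin m → Bool) :
    PathIndep (Fin.cons b f : Fin (m + 1) → Bool) ↔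
      PathIndep f ∧ (b = true → AvoidsFirst f) := by
  constructor
  · intro h
    refine ⟨fun c d hcd => ?_, fun hb a ha => ?_⟩
    · simpa using h c.succ d.succ (by simp [hcd])
    · simpa [hb] using h 0 a.succ (by simp [ha])
  · rintro ⟨h1, h2⟩ c d hcd
    induction d using Fin.cases with
    | zero => simp at hcd
    | succ d =>
      induction c using Fin.cases with
      | zero =>
        rintro ⟨hb, hd⟩
        have := h2 (by simpa using hb) d (by simp at hcd; omega)
        simp [this] at hd
      | succ c => simpa using h1 c d (by simpa using hcd)

/-- The weighted count of the independent sets of a path of order `m`, and of those of them that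
avoid the first vertex. -/
theorem sum_pathIndep (x : ℝ) (m : ℕ) : open Classical in
    (∑ f : Fin m → Bool, (if PathIndep f then ∏ a, (bif f a then x else 1) else 0) =
        pathFun (m + 1) x) ∧
      (∑ f : Fin m → Bool, (if PathIndep f ∧ AvoidsFirst f then
        ∏ a, (bif f a then x else 1) else 0) = pathFun m x) := by
  classical
  induction m with
  | zero =>
    constructor <;> simp [PathIndep, AvoidsFirst, pathFun]
  | succ m ih =>
    have key (F : (Fin (m + 1) → Bool) → ℝ) :
        ∑ f, F f = ∑ f : Fin m → Bool, F (Fin.cons true f) +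
          ∑ f : Fin m → Bool, F (Fin.cons false f) := by
      rw [← (Fin.consEquiv fun _ : Fin (m + 1) => Bool).sum_comp, Fintype.sum_prod_type]
      simp [Fin.consEquiv]
    have aux (f : Fin m → Bool) (P : Prop) [Decidable P] :
        (if P then x * ∏ a, (bif f a then x else 1) else 0) =
          x * if P then ∏ a, (bif f a then x else 1) else 0 := by
      rw [mul_ite, mul_zero]
    constructor
    · rw [key]
      simp only [pathIndep_cons, Fin.prod_univ_succ, Fin.cons_zero, Fin.cons_succ, cond_true,
        cond_false, forall_const, Bool.false_eq_true, false_imp_iff, and_true, one_mul, aux]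
      rw [← Finset.mul_sum, ih.1, ih.2, pathFun]
      ring
    · rw [key]
      simp only [pathIndep_cons, avoidsFirst_cons, Fin.prod_univ_succ, Fin.cons_zero,
        Fin.cons_succ, cond_false, Bool.true_eq_false, Bool.false_eq_true, and_false,
        false_imp_iff, and_true, if_false, one_mul, Finset.sum_const_zero, zero_add]
      exact ih.1

/-! ### Starlike trees -/

theorem sum_option_bool {α : Type*} [Fintype α] [DecidableEq α] (F : (Option α → Bool) → ℝ) :
    ∑ f, F f = ∑ g : α → Bool, F (fun o => o.elim true g) +
      ∑ g : α → Bool, F (fun o => o.elim false g) := by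
  rw [← (Equiv.piOptionEquivProd (β := fun _ : Option α => Bool)).symm.sum_comp,
    Fintype.sum_prod_type, Fintype.sum_bool]
  congr 1 <;>
  · refine Finset.sum_congr rfl fun g _ => congrArg F ?_
    ext o
    cases o <;> rfl

/-- Once the state of the centre is fixed, the legs no longer interact, so the sum factors over
them. -/
theorem starlike_indep_iff {k : ℕ} (l : Fin k → ℕ) (b : Bool)
    (g : (Σ i : Fin k, Fin (l i - 1)) → Bool) :
    (∀ u v, (starlike l).Adj u v →
      ¬ ((Option.elim u b g : Bool) = true ∧ (Option.elim v b g : Bool) = true)) ↔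
      ∀ i, PathIndep (fun a => g ⟨i, a⟩) ∧ (b = true → AvoidsFirst fun a => g ⟨i, a⟩) := by
  constructor
  · intro h i
    refine ⟨fun a c hac => ?_, fun hb a ha => ?_⟩
    · refine h (some ⟨i, a⟩) (some ⟨i, c⟩) ?_
      rw [starlike, SimpleGraph.fromRel_adj]
      refine ⟨fun e => ?_, Or.inl ⟨rfl, hac⟩⟩
      obtain rfl : a = c := by simpa using e
      omega
    · have := h none (some ⟨i, a⟩) (by
        rw [starlike, SimpleGraph.fromRel_adj]
        exact ⟨by simp, Or.inl ha⟩)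
      simpa [hb] using this
  · intro h
    have key : ∀ u v : StarlikeVertex l, (match u, v with
        | none, some ⟨_, b⟩ => b.val = 0
        | some ⟨i, a⟩, some ⟨j, b⟩ => i = j ∧ a.val + 1 = b.val
        | _, none => False) →
        ¬ ((Option.elim u b g : Bool) = true ∧ (Option.elim v b g : Bool) = true) := by
      rintro (_ | ⟨i, a⟩) (_ | ⟨j, c⟩) huv
      · exact huv.elim
      · rintro ⟨hb, hc⟩
        have := (h j).2 hb c huv
        simp [this] at hc
      · exact huv.elim
      · obtain ⟨rfl, hac⟩ := huv
        exact (h i).1 a c hac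
    intro u v huv
    rw [starlike, SimpleGraph.fromRel_adj] at huv
    rcases huv.2 with h' | h'
    · exact key u v h'
    · exact fun e => key v u h' e.symm

theorem sum_sigma_bool {k : ℕ} {l : Fin k → ℕ} (F : (i : Fin k) → (Fin (l i) → Bool) → ℝ) :
    ∑ g : (Σ i : Fin k, Fin (l i)) → Bool, ∏ i, F i (fun a => g ⟨i, a⟩) =
      ∏ i, ∑ f, F i f := by
  rw [Finset.prod_univ_sum, Fintype.piFinset_univ]
  exact (Equiv.piCurry fun (i : Fin k) (_ : Fin (l i)) => Bool).sum_comp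
    (fun h => ∏ i, F i (h i))

/-- The independence polynomial of a starlike tree. -/
theorem eval_indepPoly_starlike {k : ℕ} (l : Fin k → ℕ) (hl : ∀ i, 1 ≤ l i) (x : ℝ) :
    (indepPoly (starlike l)).eval x =
      ∏ i, pathFun (l i) x + x * ∏ i, pathFun (l i - 1) x := by
  classical
  rw [eval_indepPoly, sum_option_bool]
  simp only [starlike_indep_iff, Fintype.prod_option, Option.elim_none,
    Option.elim_some, cond_true, cond_false, Fintype.prod_sigma,
    Bool.false_eq_true, one_mul, forall_const, false_imp_iff, and_true]
  rw [add_comm]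
  congr 1
  · rw [Finset.prod_congr rfl fun i _ => show pathFun (l i) x = _ by
      rw [← Nat.sub_add_cancel (hl i), ← (sum_pathIndep x (l i - 1)).1]]
    rw [← sum_sigma_bool]
    simp [Finset.prod_ite_zero]
  · rw [Finset.prod_congr rfl fun i _ => (sum_pathIndep x (l i - 1)).2.symm, ← sum_sigma_bool,
      Finset.mul_sum]
    simp [Finset.prod_ite_zero]

/-- The value at `x` of the independence polynomial of the tree consisting of a centre with `a`
pendant vertices and a path of order `m` attached to it. -/
def broomFun (a m : ℕ) (x : ℝ) : ℝ :=
  (1 + x) ^ a * pathFun (m + 1) x + x * pathFun m x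

theorem eval_indepPoly_treeT (n k : ℕ) (hk : 1 ≤ k) (x : ℝ) :
    (indepPoly (treeT n k)).eval x = broomFun (k - 1) (n - k) x := by
  obtain ⟨a, rfl⟩ := Nat.exists_eq_add_of_le' hk
  rw [treeT, eval_indepPoly_starlike _ (fun i => by unfold broomLegs; split_ifs <;> omega)]
  simp [Fin.prod_univ_succ, broomLegs, broomFun, pathFun]
  ring

/-! ### Double stars -/

theorem sum_sum_bool {α β : Type*} [Fintype α] [Fintype β] [DecidableEq α] [DecidableEq β]
    (F : (α ⊕ β → Bool) → ℝ) :
    ∑ f, F f = ∑ g : α → Bool, ∑ h : β → Bool, F (Sum.elim g h) := by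
  rw [← (Equiv.sumArrowEquivProdArrow α β Bool).symm.sum_comp, Fintype.sum_prod_type]
  rfl

/-- The independent sets of a double star, in terms of the two centres and their leaves. -/
theorem doubleStar_indep_iff (n k : ℕ) (b c : Bool) (g : Fin (k - 1) → Bool)
    (h : Fin (n - k - 1) → Bool) :
    (∀ u v, (doubleStar n k).Adj u v →
      ¬ ((Sum.elim (fun o => Option.elim o b g) (fun o => Option.elim o c h) u : Bool) = true ∧
        (Sum.elim (fun o => Option.elim o b g) (fun o => Option.elim o c h) v : Bool) = true)) ↔
      ¬ (b = true ∧ c = true) ∧ (∀ i, b = true → g i = false) ∧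
        (∀ i, c = true → h i = false) := by
  simp only [doubleStar, SimpleGraph.sup_adj, SimpleGraph.edge_adj]
  constructor
  · intro H
    refine ⟨?_, fun i hb => ?_, fun i hc => ?_⟩
    · simpa using H (Sum.inl none) (Sum.inr none) (by simp)
    · simpa [hb] using H (Sum.inl none) (Sum.inl (some i)) (by simp [SimpleGraph.starGraph])
    · simpa [hc] using H (Sum.inr none) (Sum.inr (some i)) (by simp [SimpleGraph.starGraph])
  · rintro ⟨h1, h2, h3⟩
    rintro ((_ | u) | (_ | u)) ((_ | v) | (_ | v)) huv <;>
      simp [SimpleGraph.starGraph] at huv h1 h2 h3 ⊢ <;> grind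

theorem eval_indepPoly_doubleStar (n k : ℕ) (x : ℝ) :
    (indepPoly (doubleStar n k)).eval x =
      (1 + x) ^ (k - 1) * (1 + x) ^ (n - k - 1) + x * (1 + x) ^ (n - k - 1) +
        x * (1 + x) ^ (k - 1) := by
  classical
  have leaves (m : ℕ) (b : Bool) : ∑ g : Fin m → Bool, (if ∀ i, b = true → g i = false then
      ∏ i, (bif g i then x else 1) else 0) = if b then 1 else (1 + x) ^ m := by
    trans ∑ g : Fin m → Bool, ∏ i, if b = true → g i = false then bif g i then x else 1 else 0
    · simp only [Finset.prod_ite_zero, mem_univ, true_imp_iff]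
    · rw [sum_bool_prod fun _ c => if b = true → c = false then bif c then x else 1 else 0]
      cases b <;> simp [add_comm]
  have split (P Q : Prop) [Decidable P] [Decidable Q] [Decidable (P ∧ Q)] (b c y z : ℝ) :
      (if P ∧ Q then b * y * (c * z) else 0) =
        b * c * ((if P then y else 0) * (if Q then z else 0)) := by
    split_ifs <;> simp_all; ring
  -- With the states `b`, `c` of the two centres fixed, the two sets of leaves contribute
  -- independent factors.
  have key (b c : Bool) : (∑ g : Fin (k - 1) → Bool, ∑ h : Fin (n - k - 1) → Bool,
      if ¬ (b = true ∧ c = true) ∧ (∀ i, b = true → g i = false) ∧ (∀ i, c = true → h i = false)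
      then (bif b then x else 1) * (∏ i, (bif g i then x else 1)) *
        ((bif c then x else 1) * ∏ i, (bif h i then x else 1)) else 0) =
      if b = true ∧ c = true then 0 else (bif b then x else 1) * (bif c then x else 1) *
        ((if b then 1 else (1 + x) ^ (k - 1)) * (if c then 1 else (1 + x) ^ (n - k - 1))) := by
    by_cases hbc : b = true ∧ c = true
    · simp [hbc]
    · rw [if_neg hbc, ← leaves (k - 1) b, ← leaves (n - k - 1) c, Finset.sum_mul_sum,
        Finset.mul_sum]
      refine Finset.sum_congr rfl fun g _ => ?_
      rw [Finset.mul_sum]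
      refine Finset.sum_congr rfl fun h _ => ?_
      rw [← split]
      simp only [hbc, not_false_eq_true, true_and]
  rw [eval_indepPoly, sum_sum_bool, sum_option_bool]
  simp only [sum_option_bool (α := Fin (n - k - 1)), doubleStar_indep_iff, Fintype.prod_sum_type,
    Fintype.prod_option, Sum.elim_inl, Sum.elim_inr, Option.elim_none, Option.elim_some,
    Finset.sum_add_distrib]
  refine (congrArg₂ (· + ·) (congrArg₂ (· + ·) ((Eq.trans ?_ (key true true)))
    ((Eq.trans ?_ (key true false)))) (congrArg₂ (· + ·) ((Eq.trans ?_ (key false true)))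
    ((Eq.trans ?_ (key false false))))).trans ?_
  · congr! <;> simp
  · congr! <;> simp
  · congr! <;> simp
  · congr!
  · simp
    ring

/-! ### Analysis of the values -/

theorem continuous_pathFun (m : ℕ) : Continuous (pathFun m) := by
  induction m using Nat.twoStepInduction with
  | zero => exact continuous_const
  | one => exact continuous_const
  | more m h0 h1 => exact h1.add (continuous_id.mul h0)

theorem pathFun_pos_of_nonneg (m : ℕ) {x : ℝ} (hx : 0 ≤ x) : 0 < pathFun m x := by
  induction m using Nat.twoStepInduction with
  | zero => exact one_pos
  | one => exact one_pos
  | more m h0 h1 => exact add_pos_of_pos_of_nonneg h1 (mul_nonneg hx h0.le)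

/-- If `f 0 > 0` and `f` is not positive on `[y, 0]`, then it has a largest zero there. -/
theorem exists_last_zero {f : ℝ → ℝ} (hf : Continuous f) (h0 : 0 < f 0) {y : ℝ}
    (h : ¬ ∀ x ∈ Set.Icc y 0, 0 < f x) :
    ∃ z ∈ Set.Ico y 0, f z = 0 ∧ ∀ x ∈ Set.Ioc z 0, 0 < f x := by
  push Not at h
  obtain ⟨w, hw, hfw⟩ := h
  have hne : (Set.Icc y 0 ∩ f ⁻¹' {0}).Nonempty := by
    obtain ⟨c, hc, hc0⟩ := intermediate_value_Icc hw.2 hf.continuousOn ⟨hfw, h0.le⟩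
    exact ⟨c, ⟨hw.1.trans hc.1, hc.2⟩, hc0⟩
  obtain ⟨z, ⟨hz, hz0⟩, hmax⟩ :=
    (isCompact_Icc.inter_right (isClosed_singleton.preimage hf)).exists_isGreatest hne
  have hz0 : f z = 0 := hz0
  refine ⟨z, ⟨hz.1, hz.2.lt_of_ne ?_⟩, hz0, fun x hx => ?_⟩
  · rintro rfl
    exact h0.ne' hz0
  · by_contra hneg
    obtain ⟨c, hc, hc0⟩ := intermediate_value_Icc hx.2 hf.continuousOn ⟨not_lt.1 hneg, h0.le⟩
    exact (hx.1.trans_le hc.1).not_ge (hmax ⟨⟨hz.1.trans (hx.1.le.trans hc.1), hc.2⟩, hc0⟩)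

/-- A continuous function that is positive on `(z, 0]` is nonnegative at `z`. -/
theorem nonneg_of_pos_Ioc {f : ℝ → ℝ} (hf : Continuous f) {z : ℝ} (hz : z < 0)
    (h : ∀ x ∈ Set.Ioc z 0, 0 ≤ f x) : 0 ≤ f z := by
  have hcl : z ∈ closure (Set.Ioc z 0) := by
    rw [closure_Ioc hz.ne]
    exact ⟨le_rfl, hz.le⟩
  exact (isClosed_Ici.preimage hf).closure_subset_iff.2 h hcl

/-- At the last zero `z < 0` of `pathFun (m + 1)`, the recursion leaves `pathFun (m + 2) z = z *
pathFun m z`, which is at most `0` because induction keeps `pathFun m` nonnegative up to `z`. -/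
theorem pathFun_pos_of_succ (m : ℕ) : ∀ y : ℝ,
    (∀ x ∈ Set.Icc y 0, 0 < pathFun (m + 1) x) → ∀ x ∈ Set.Icc y 0, 0 < pathFun m x := by
  induction m with
  | zero => exact fun y _ x _ => one_pos
  | succ m ih =>
    intro y h
    by_contra hneg
    obtain ⟨z, hz, hz0, hpos⟩ := exists_last_zero (continuous_pathFun (m + 1))
      (pathFun_pos_of_nonneg _ le_rfl) hneg
    have h1 : 0 ≤ pathFun m z := nonneg_of_pos_Ioc (continuous_pathFun m) hz.2 fun x hx =>
      (ih x (fun t ht => hpos t ⟨hx.1.trans_le ht.1, ht.2⟩) x ⟨le_rfl, hx.2⟩).le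
    have h2 := h z ⟨hz.1, hz.2.le⟩
    rw [pathFun, hz0, zero_add] at h2
    exact h2.not_ge (mul_nonpos_of_nonpos_of_nonneg hz.2.le h1)

theorem pathFun_pos_of_le {i m : ℕ} (him : i ≤ m) {y : ℝ}
    (h : ∀ x ∈ Set.Icc y 0, 0 < pathFun m x) : ∀ x ∈ Set.Icc y 0, 0 < pathFun i x := by
  induction m, him using Nat.le_induction with
  | base => exact h
  | succ m _ ih => exact ih (pathFun_pos_of_succ m y h)

theorem broomFun_pos_of_nonneg (a m : ℕ) {x : ℝ} (hx : 0 ≤ x) : 0 < broomFun a m x :=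
  add_pos_of_pos_of_nonneg (mul_pos (by positivity) (pathFun_pos_of_nonneg _ hx))
    (mul_nonneg hx (pathFun_pos_of_nonneg _ hx).le)

/-- Same mechanism: at the last zero of the path factor only `z * pathFun m z ≤ 0` survives. -/
theorem pathFun_pos_of_broomFun_pos {a m : ℕ} {y : ℝ}
    (h : ∀ x ∈ Set.Icc y 0, 0 < broomFun a m x) :
    ∀ x ∈ Set.Icc y 0, 0 < pathFun (m + 1) x := by
  by_contra hneg
  obtain ⟨z, hz, hz0, hpos⟩ := exists_last_zero (continuous_pathFun (m + 1))
    (pathFun_pos_of_nonneg _ le_rfl) hneg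
  have h1 : 0 ≤ pathFun m z := nonneg_of_pos_Ioc (continuous_pathFun m) hz.2 fun x hx =>
    (pathFun_pos_of_succ m x (fun t ht => hpos t ⟨hx.1.trans_le ht.1, ht.2⟩) x ⟨le_rfl, hx.2⟩).le
  have h2 := h z ⟨hz.1, hz.2.le⟩
  rw [broomFun, hz0, mul_zero, zero_add] at h2
  exact h2.not_ge (mul_nonpos_of_nonpos_of_nonneg hz.2.le h1)

theorem broomFun_sub_broomFun (a m : ℕ) (x : ℝ) :
    broomFun a (m + 2) x - broomFun (a + 1) (m + 1) x =
      x ^ 2 * pathFun m x * (1 - (1 + x) ^ a) := by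
  simp only [broomFun, pathFun]
  ring

/-- For `a = 0` both sides are the same path polynomial, hence `a ≠ 0`. -/
theorem broomFun_lt_broomFun {a m : ℕ} (ha : a ≠ 0) {y : ℝ} (hy : -1 < y)
    (h : ∀ x ∈ Set.Icc y 0, 0 < broomFun (a + 1) (m + 1) x) :
    ∀ x ∈ Set.Ico y 0, broomFun (a + 1) (m + 1) x < broomFun a (m + 2) x := by
  intro x hx
  have h1 := pathFun_pos_of_le (i := m) (by omega) (pathFun_pos_of_broomFun_pos h) x
    ⟨hx.1, hx.2.le⟩
  have h2 : (1 + x) ^ a < 1 := pow_lt_one₀ (by linarith [hx.1]) (by linarith [hx.2]) ha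
  rw [← sub_pos, broomFun_sub_broomFun]
  have := sq_pos_of_neg hx.2
  have := sub_pos.2 h2
  positivity

theorem broomFun_zero (a m : ℕ) : broomFun a m 0 = 1 := by
  have (m : ℕ) : pathFun m 0 = 1 := by
    induction m using Nat.twoStepInduction <;> simp_all [pathFun]
  simp [broomFun, this]

theorem broomFun_lt_broomFun_of_lt {d a m : ℕ} (ha : a ≠ 0) {y : ℝ} (hy : -1 < y)
    (h : ∀ x ∈ Set.Icc y 0, 0 < broomFun (a + (d + 1)) (m + 1) x) :
    ∀ x ∈ Set.Ico y 0, broomFun (a + (d + 1)) (m + 1) x < broomFun a (m + 1 + (d + 1)) x := by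
  induction d generalizing a with
  | zero => exact broomFun_lt_broomFun ha hy h
  | succ d ih =>
    have e : a + (d + 1 + 1) = a + 1 + (d + 1) := by omega
    rw [e] at h ⊢
    have h1 := ih (a := a + 1) (by omega) h
    -- Positivity passes up the chain, since each polynomial exceeds the previous positive one.
    have h2 : ∀ x ∈ Set.Icc y 0, 0 < broomFun (a + 1) (m + 1 + d + 1) x := by
      intro x hx
      rcases hx.2.lt_or_eq with hx0 | rfl
      · exact (h x hx).trans (h1 x ⟨hx.1, hx0⟩)
      · exact broomFun_pos_of_nonneg _ _ le_rfl
    exact fun x hx => (h1 x hx).trans (broomFun_lt_broomFun ha hy h2 x hx)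

theorem not_forall_broomFun_pos (a m : ℕ) :
    ¬ ∀ x ∈ Set.Icc (-1 : ℝ) 0, 0 < broomFun a (m + 1) x := by
  intro h
  -- `pathFun 2` is `1 + x`, which vanishes at `-1`.
  have := pathFun_pos_of_le (i := 2) (by omega) (pathFun_pos_of_broomFun_pos h) (-1) (by simp)
  simp [pathFun] at this

/-- A criterion for `G ≻ H`. -/
theorem strictlyDominates_of_lt {V W : Type*} [Fintype V] [Fintype W] {G : SimpleGraph V}
    {H : SimpleGraph W} {g h : ℝ → ℝ} (hG : ∀ x, (indepPoly G).eval x = g x)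
    (hH : ∀ x, (indepPoly H).eval x = h x) (hpos : ∀ x, 0 ≤ x → 0 < g x)
    (hnot : ¬ ∀ x ∈ Set.Icc (-1 : ℝ) 0, 0 < g x) (h0 : g 0 = h 0)
    (hlt : ∀ x ∈ Set.Ioo (-1 : ℝ) 0, (∀ t ∈ Set.Icc x 0, 0 < g t) → g x < h x) :
    StrictlyDominates G H := by
  have hg : Continuous g := by
    simpa only [← funext hG] using (indepPoly G).continuous
  have hh : Continuous h := by
    simpa only [← funext hH] using (indepPoly H).continuous
  obtain ⟨ξ, hξ, hξ0, hgt⟩ := exists_last_zero hg (hpos 0 le_rfl) hnot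
  have key : ∀ x ∈ Set.Ioo ξ 0, g x < h x := fun x hx =>
    hlt x ⟨hξ.1.trans_lt hx.1, hx.2⟩ fun t ht => hgt t ⟨hx.1.trans_le ht.1, ht.2⟩
  have key' : ∀ x ∈ Set.Ioc ξ 0, 0 ≤ h x - g x := by
    intro x hx
    rcases hx.2.lt_or_eq with hx0 | rfl
    · exact sub_nonneg.2 (key x ⟨hx.1, hx0⟩).le
    · exact sub_nonneg.2 h0.le
  refine ⟨⟨ξ, ⟨(hG ξ).trans hξ0, fun x hx => ?_⟩, fun x hx => ?_⟩, fun e => ?_⟩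
  · by_contra hlt'
    have hx : g x = 0 := (hG x).symm.trans hx
    rcases le_total x 0 with hx0 | hx0
    · exact (hgt x ⟨not_le.1 hlt', hx0⟩).ne' hx
    · exact (hpos x hx0).ne' hx
  · rw [hG, hH]
    rcases hx.1.lt_or_eq with hx' | rfl
    · exact sub_nonneg.1 (key' x ⟨hx', hx.2⟩)
    · exact sub_nonneg.1 (nonneg_of_pos_Ioc (f := fun t => h t - g t) (hh.sub hg) hξ.2 key')
  -- Any point of `(ξ, 0)` separates the two polynomials.
  · have := key (ξ / 2) ⟨by linarith [hξ.2], by linarith [hξ.2]⟩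
    rw [← hG, ← hH, e] at this
    exact this.false

theorem treeT_strictlyDominates {n j k : ℕ} (hk : 2 ≤ k) (hkj : k < j) (hj : j ≤ n - 1) :
    StrictlyDominates (treeT n j) (treeT n k) := by
  obtain ⟨d, rfl⟩ := Nat.exists_eq_add_of_lt hkj
  obtain ⟨a, rfl⟩ := Nat.exists_eq_add_of_le' hk
  obtain ⟨m, rfl⟩ : ∃ m, n = m + 1 + (a + 2 + d + 1) := ⟨n - (a + 2 + d + 1) - 1, by omega⟩
  refine strictlyDominates_of_lt (g := broomFun (a + 1 + (d + 1)) (m + 1))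
    (h := broomFun (a + 1) (m + 1 + (d + 1))) (fun x => ?_) (fun x => ?_)
    (fun x => broomFun_pos_of_nonneg _ _) (not_forall_broomFun_pos _ _)
    (by rw [broomFun_zero, broomFun_zero])
    fun x hx h => broomFun_lt_broomFun_of_lt (by omega) hx.1 h x ⟨le_rfl, hx.2⟩
  · rw [eval_indepPoly_treeT _ _ (by omega)]
    rw [show a + 2 + d + 1 - 1 = a + 1 + (d + 1) by omega, Nat.add_sub_cancel]
  · rw [eval_indepPoly_treeT _ _ (by omega)]
    congr 1
    omega

theorem doubleStar_strictlyDominates {n j k : ℕ} (hk : n ≤ 2 * k) (hkj : k < j)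
    (hj : j ≤ n - 1) : StrictlyDominates (doubleStar n j) (doubleStar n k) := by
  refine strictlyDominates_of_lt (eval_indepPoly_doubleStar n j) (eval_indepPoly_doubleStar n k)
    (fun x hx => by positivity) (fun h => ?_) (by simp) fun x hx _ => ?_
  · have h1 := h (-1) (by simp)
    have h2 : (1 + -1 : ℝ) ^ (j - 1) = 0 := by
      rw [add_neg_cancel, zero_pow (by omega)]
    have h3 : (0 : ℝ) ≤ (1 + -1) ^ (n - j - 1) := by positivity
    rw [h2] at h1
    linarith
  · obtain ⟨d, rfl⟩ := Nat.exists_eq_add_of_lt hkj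
    obtain ⟨q, rfl⟩ : ∃ q, k = q + 1 := ⟨k - 1, by omega⟩
    obtain ⟨r, rfl⟩ : ∃ r, n = r + 1 + (q + 1 + d + 1) := ⟨n - (q + 1 + d + 1) - 1, by omega⟩
    have e1 : q + 1 + d + 1 - 1 = q + (d + 1) := by omega
    have e2 : r + 1 + (q + 1 + d + 1) - (q + 1 + d + 1) - 1 = r := by omega
    have e3 : r + 1 + (q + 1 + d + 1) - (q + 1) - 1 = r + (d + 1) := by omega
    -- In the original parameters `s = k + j - n`, positive because `n ≤ 2 * k < k + j`. With `t = 1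
    -- + x` the difference is `-x * t ^ r * (1 - t ^ (d + 1)) * (1 - t ^ s)`.
    obtain ⟨s, hs, rfl⟩ : ∃ s, s ≠ 0 ∧ q = r + s := ⟨q - r, by omega, by omega⟩
    rw [e1, e2, e3, Nat.add_sub_cancel]
    have t0 : 0 < 1 + x := by linarith [hx.1]
    have t1 : 1 + x < 1 := by linarith [hx.2]
    have h1 := sub_pos.2 (pow_lt_one₀ t0.le t1 (Nat.succ_ne_zero d))
    have h2 := sub_pos.2 (pow_lt_one₀ t0.le t1 hs)
    have h3 := mul_pos (mul_pos (pow_pos t0 r) (mul_pos h1 h2)) (neg_pos.2 hx.2)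
    rw [← sub_pos]
    refine h3.trans_eq ?_
    simp only [pow_add, Nat.succ_eq_add_one]
    ring

end IndepOrder

theorem mainTheorem4 (n : ℕ) (hn : 2 ≤ n) :
    (∀ j k : ℕ, 2 ≤ k → k < j → j ≤ n - 1 →
      IndepOrder.StrictlyDominates (IndepOrder.treeT n j) (IndepOrder.treeT n k)) ∧
    (∀ j k : ℕ, ⌈(n : ℚ) / 2⌉₊ ≤ k → k < j → j ≤ n - 1 →
      IndepOrder.StrictlyDominates (IndepOrder.doubleStar n j) (IndepOrder.doubleStar n k)) := by
  refine ⟨fun j k => IndepOrder.treeT_strictlyDominates, fun j k hk =>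
    IndepOrder.doubleStar_strictlyDominates ?_⟩
  have h := Nat.ceil_le.1 hk
  have h' : (n : ℚ) ≤ 2 * k := by linarith
  exact_mod_cast h'
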